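/- Fix an integer $m\ge 2$ and let $\Sigma=\{\alpha_1,\dots,\alpha_m,\beta_1,\dots,\beta_m\}$ with the discrete topology. Let $M$ be the monoid with zero generated by $\Sigma$ subject to the relations $\alpha_j\beta_j=1$ for all $j$ and $\alpha_i\beta_j=0$ for $i\ne j$. The two-sided Dyck shift $X\subset\Sigma^{\mathbb Z}$ is the set of all $x$ such that for all $r\le l$ the product $x_r x_{r+1}\cdots x_l$ is non-zero in $M$. Let $\mathcal T_2(X)$ be the double-tail relation on $X$: $(x,x')\in\mathcal T_2(X)$ if and only if there is $n\ge 0$ with $x_k=x'_k$ for all $|k|>n$. A $\mathcal T_2(X)$-holonomy is an injective Borel map $g:A\to X$, with $A\subset X$ Borel, such that $(x,g(x))\in\mathcal T_2(X)$ for every $x\in A$. A Borel probability measure $\mu$ on $X$ is $\mathcal T_2(X)$-invariant if $\mu(A)=\mu(g(A))$ for every such holonomy $g:A\to X$. For a letter put $\sigma(\alpha_j)=1$ and $\sigma(\beta_j)=-1$. For $x\in X$ let $H_i(x)=\sum_{j=0}^{i-1}\sigma(x_j)$ if $i>0$, $H_0(x)=0$, and $H_i(x)=-\sum_{j=i}^{-1}\sigma(x_j)$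 if $i<0$. For $s,t\subset[-\infty,+\infty]$ let $$B^s_t=\Bigl\{x\in X:\ \liminf_{i\to+\infty}H_i(x)\in s,\ \liminf_{i\to-\infty}H_i(x)\in t\Bigr\}.$$ Lemma. For all $s,t\in\{\{+\infty\},\mathbb R\}$ there is no $\mathcal T_2(X)$-invariant Borel probability measure $\mu$ on $X$ with $\mu(B^s_t)=1$. -/

import Mathlib

open MeasureTheory Filter

namespace Dyck

section DoubleTail

variable {S : Type*}

/-- The double-tail (homoclinic) relation of a set `X` of two-sided sequences. -/
def DoubleTail (X : Set (ℤ → S)) (x x' : X) : Prop :=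
  ∃ n : ℕ, ∀ k : ℤ, (n : ℤ) < |k| → x.1 k = x'.1 k

variable [MeasurableSpace S]

/-- A holonomy of the double-tail relation of `X`: an injective Borel map `g : A → X`, defined on
a Borel set `A ⊆ X`, with `x` and `g x` double-tail equivalent for all `x ∈ A`. -/
structure IsHolonomy (X : Set (ℤ → S)) (A : Set X) (g : A → X) : Prop where
  measurableSet : MeasurableSet A
  measurable : Measurable g
  injective : Function.Injective g
  tail : ∀ x : A, DoubleTail X x (g x)

/-- A measure on `X` is double-tail invariant if `μ A = μ (g A)` for every holonomy
`g : A → X` of the double-tail relation. -/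
def IsDoubleTailInvariant (X : Set (ℤ → S)) (μ : Measure X) : Prop :=
  ∀ (A : Set X) (g : A → X), IsHolonomy X A g → μ A = μ (Set.range g)

end DoubleTail

/-- The alphabet `α_1, …, α_m, β_1, …, β_m`. -/
inductive Letter (m : ℕ) : Type
  | alpha (j : Fin m) : Letter m
  | beta (j : Fin m) : Letter m

/-- The alphabet carries the discrete topology. -/
instance (m : ℕ) : TopologicalSpace (Letter m) := ⊥

instance (m : ℕ) : DiscreteTopology (Letter m) := ⟨rfl⟩

/-- The Borel sets of the alphabet, so that `ℤ → Letter m` and its subsets carry their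
Borel sets for the product topology. -/
instance (m : ℕ) : MeasurableSpace (Letter m) := borel (Letter m)

instance (m : ℕ) : BorelSpace (Letter m) := ⟨rfl⟩

instance (m : ℕ) : Finite (Letter m) :=
  Finite.of_surjective (fun a : Fin m ⊕ Fin m => Sum.elim Letter.alpha Letter.beta a) (by
    rintro (j | j)
    · exact ⟨Sum.inl j, rfl⟩
    · exact ⟨Sum.inr j, rfl⟩)

/-- The free monoid with zero on the alphabet. -/
abbrev FreeWithZero (m : ℕ) : Type := WithZero (FreeMonoid (Letter m))

/-- A letter as a generator of the free monoid with zero. -/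
def gen {m : ℕ} (a : Letter m) : FreeWithZero m := ((FreeMonoid.of a : FreeMonoid (Letter m)) : _)

/-- The defining relations of the Dyck monoid: `α_j β_j ≡ 1`, and `α_i β_j ≡ 0` for `i ≠ j`. -/
inductive DyckRel (m : ℕ) : FreeWithZero m → FreeWithZero m → Prop
  | cancel (j : Fin m) : DyckRel m (gen (.alpha j) * gen (.beta j)) 1
  | zero (i j : Fin m) (h : i ≠ j) : DyckRel m (gen (.alpha i) * gen (.beta j)) 0

/-- The Dyck monoid: the monoid with zero presented by the relations `DyckRel`. -/
abbrev DyckMonoid (m : ℕ) : Type := (conGen (DyckRel m)).Quotient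

/-- The zero of the Dyck monoid. -/
def dyckZero (m : ℕ) : DyckMonoid m := ((0 : FreeWithZero m) : DyckMonoid m)

/-- The class of a word in the Dyck monoid, that is, the product of its letters. -/
def wordClass {m : ℕ} (w : List (Letter m)) : DyckMonoid m :=
  (((FreeMonoid.ofList w : FreeMonoid (Letter m)) : FreeWithZero m) : DyckMonoid m)

/-- The Dyck language: the words that are not zero in the Dyck monoid. -/
def language (m : ℕ) : Set (List (Letter m)) := {w | wordClass w ≠ dyckZero m}

/-- The word `x_r x_{r+1} … x_l`, for `r ≤ l`. -/
def block {m : ℕ} (x : ℤ → Letter m) (r l : ℤ) : List (Letter m) :=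
  (List.range (l - r + 1).toNat).map fun k : ℕ => x (r + (k : ℤ))

/-- The two-sided Dyck shift. -/
def shift (m : ℕ) : Set (ℤ → Letter m) := {x | ∀ r l : ℤ, r ≤ l → block x r l ∈ language m}

/-- `+1` on the letters `α_j` and `-1` on the letters `β_j`. -/
def sign {m : ℕ} : Letter m → ℤ
  | .alpha _ => 1
  | .beta _ => -1

/-- The height `H_i(x)`. -/
noncomputable def height {m : ℕ} (x : ℤ → Letter m) (i : ℤ) : ℤ :=
  if 0 ≤ i then ∑ j ∈ Finset.Ico 0 i, sign (x j) else ∑ j ∈ Finset.Ico i 0, -sign (x j)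

/-- The set `B^s_t` of the points of the Dyck shift whose height has its lower limit at `+∞` in `s`
and its lower limit at `-∞` in `t`; lower limits are taken in the extended reals. -/
def B (m : ℕ) (s t : Set EReal) : Set (shift m) :=
  {x | liminf (fun i : ℤ => ((height x.1 i : ℝ) : EReal)) atTop ∈ s ∧
    liminf (fun i : ℤ => ((height x.1 i : ℝ) : EReal)) atBot ∈ t}

end Dyck

/-! If both lower limits avoid `⊥`, the integer-valued height is bounded below and attains a global
minimum. It thus suffices that an invariant probability measure gives mass zero to the points with a
minimum (`ae_not_isMinAt`).

At a minimum `k` the letter is some `α_a`. Nothing to its left leaves an unmatched `α`, so replacing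
`α_a` by `β_a` stays in the shift (`flip_mem_shift`). This flip is a holonomy and lowers the heights
after `k` by 2 relative to those up to `k`.

If the minimum at `k` recurs later, the flipped point reaches one above its minimum for the first
time at `k + 1`. Such sets are disjoint over `k`, so the measures of the sets before flipping are
summable and, by Borel–Cantelli, almost every point with a minimum has a last one. If `k` is the
last minimum, flipping makes `k + 1` the first one. Summing over `k ≥ K`, the mass of "last minimum
at or after `K`" is at most that of "first minimum after `K`", hence at most that of "last minimum
after `K`". So no mass has its last minimum at `K`. -/

namespace Dyck

/-! ### Non-zero words in the Dyck monoid. -/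

section Monoid

variable {m : ℕ}

/-- The product in the free monoid with zero of the letters of a word. -/
def wordProd (w : List (Letter m)) : FreeWithZero m :=
  ((FreeMonoid.ofList w : FreeMonoid (Letter m)) : FreeWithZero m)

theorem wordClass_append (u v : List (Letter m)) :
    wordClass (u ++ v) = wordClass u * wordClass v := rfl

theorem wordClass_nil : wordClass ([] : List (Letter m)) = 1 := rfl

theorem wordClass_mul_dyckZero (u : List (Letter m)) : wordClass u * dyckZero m = dyckZero m := by
  change (((wordProd u * 0 : FreeWithZero m)) : DyckMonoid m) = _
  rw [mul_zero]; rfl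

theorem dyckZero_mul_wordClass (u : List (Letter m)) : dyckZero m * wordClass u = dyckZero m := by
  change (((0 * wordProd u : FreeWithZero m)) : DyckMonoid m) = _
  rw [zero_mul]; rfl

theorem wordClass_cancel (a : Fin m) : wordClass [Letter.alpha a, Letter.beta a] = 1 :=
  (Con.eq _).2 (ConGen.Rel.of _ _ (DyckRel.cancel a))

theorem wordClass_mismatch {a b : Fin m} (h : a ≠ b) :
    wordClass [Letter.alpha a, Letter.beta b] = dyckZero m :=
  (Con.eq _).2 (ConGen.Rel.of _ _ (DyckRel.zero a b h))

theorem language_append {u v : List (Letter m)} (h : u ++ v ∈ language m) :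
    u ∈ language m ∧ v ∈ language m := by
  constructor
  · intro hu
    exact h (by rw [wordClass_append, hu, dyckZero_mul_wordClass])
  · intro hv
    exact h (by rw [wordClass_append, hv, wordClass_mul_dyckZero])

/-- The operator that represents a letter on the functions on stacks. -/
def letterOp : Letter m → Module.End ℤ (List (Fin m) → ℤ)
  | .alpha a =>
    { toFun := fun f s => f (a :: s)
      map_add' := fun _ _ => rfl
      map_smul' := fun _ _ => rfl }
  | .beta b =>
    { toFun := fun f s => if s.head? = some b then f s.tail else 0
      map_add' := fun f g => by ext s; simp only [Pi.add_apply]; split_ifs <;> simp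
      map_smul' := fun c f => by ext s; simp }

/-- The representation of the free monoid with zero on the functions on stacks. -/
noncomputable def stackRep (m : ℕ) : FreeWithZero m →*₀ Module.End ℤ (List (Fin m) → ℤ) :=
  WithZero.lift' (FreeMonoid.lift letterOp)

theorem stackRep_gen (a : Letter m) : stackRep m (gen a) = letterOp a := by
  simp [stackRep, gen]

theorem stackRep_wordProd_cons (a : Letter m) (w : List (Letter m)) :
    stackRep m (wordProd (a :: w)) = letterOp a * stackRep m (wordProd w) := by
  rw [← stackRep_gen, ← map_mul]; rfl

theorem stackRep_wordProd_nil : stackRep m (wordProd []) = 1 := map_one (stackRep m)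

theorem stackRep_eq_zero_of_wordClass {w : List (Letter m)} (h : wordClass w = dyckZero m) :
    stackRep m (wordProd w) = 0 := by
  have hcoe : ∀ z, (stackRep m).toMonoidHom z = stackRep m z := fun _ => rfl
  have hle : conGen (DyckRel m) ≤ Con.ker (stackRep m).toMonoidHom := by
    rw [Con.conGen_le]
    rintro x y (⟨a⟩ | ⟨a, b, hab⟩)
    · rw [Con.ker_rel, hcoe, hcoe, map_mul, stackRep_gen, stackRep_gen, map_one]
      ext f s
      simp [letterOp]
    · rw [Con.ker_rel, hcoe, hcoe, map_mul, stackRep_gen, stackRep_gen, map_zero]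
      refine LinearMap.ext fun f => funext fun s => ?_
      simp [letterOp, hab]
  have h2 : stackRep m (wordProd w) = stackRep m 0 := hle ((Con.eq _).1 h)
  rw [h2, map_zero]

theorem stackRep_map_alpha (as : List (Fin m)) :
    stackRep m (wordProd (as.map Letter.alpha)) (fun _ => 1) = fun _ => 1 := by
  induction as with
  | nil => rw [List.map_nil, stackRep_wordProd_nil]; rfl
  | cons a as ih => rw [List.map_cons, stackRep_wordProd_cons, Module.End.mul_apply, ih]; rfl

theorem stackRep_map_beta_ne_zero (bs : List (Fin m)) {f : List (Fin m) → ℤ} (hf : f ≠ 0) :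
    stackRep m (wordProd (bs.map Letter.beta)) f ≠ 0 := by
  induction bs with
  | nil => rwa [List.map_nil, stackRep_wordProd_nil]
  | cons b bs ih =>
    rw [List.map_cons, stackRep_wordProd_cons, Module.End.mul_apply]
    intro h
    refine ih (funext fun s => ?_)
    simpa [letterOp] using congrFun h (b :: s)

/-- In the stack representation the letters `α` fix the constant function 1 and the letters `β` act
injectively, so the word does not act as zero. -/
theorem normalForm_mem_language (bs as : List (Fin m)) :
    bs.map Letter.beta ++ as.map Letter.alpha ∈ language m := by
  intro h
  have h0 : stackRep m (wordProd (bs.map Letter.beta) * wordProd (as.map Letter.alpha)) = 0 :=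
    stackRep_eq_zero_of_wordClass h
  rw [map_mul] at h0
  refine stackRep_map_beta_ne_zero bs (f := fun _ => 1) (fun h1 => ?_) ?_
  · exact one_ne_zero (congrFun h1 [])
  · have := LinearMap.congr_fun h0 (fun _ => 1)
    rwa [Module.End.mul_apply, stackRep_map_alpha] at this

/-- A word that is not zero reduces to a word `β ⋯ β α ⋯ α`, and the number of letters `α` of the
latter is the height of some suffix. -/
theorem exists_normalForm {w : List (Letter m)} (hw : w ∈ language m) :
    ∃ bs as : List (Fin m), wordClass w = wordClass (bs.map Letter.beta ++ as.map Letter.alpha) ∧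
      ∃ v, v <:+ w ∧ (v.map sign).sum = as.length := by
  induction w using List.reverseRecOn with
  | nil => exact ⟨[], [], rfl, [], List.suffix_rfl, rfl⟩
  | append_singleton w c ih =>
    obtain ⟨bs, as, hcl, v, hv, hsum⟩ := ih (language_append hw).1
    have hvc : v ++ [c] <:+ w ++ [c] := by
      obtain ⟨u, rfl⟩ := hv
      exact ⟨u, by simp⟩
    cases c with
    | alpha a =>
      refine ⟨bs, as ++ [a], ?_, _, hvc, ?_⟩
      · rw [wordClass_append, hcl, ← wordClass_append]; simp
      · simp [hsum, sign]
    | beta b =>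
      rcases List.eq_nil_or_concat as with rfl | ⟨as, a, rfl⟩
      -- With no `α` left to cancel, `β_b` joins the `β` part, and the empty suffix has height 0.
      · refine ⟨bs ++ [b], [], ?_, [], List.nil_suffix, rfl⟩
        rw [wordClass_append, hcl, ← wordClass_append]; simp
      · have hcl' : wordClass (w ++ [Letter.beta b]) =
            wordClass (bs.map Letter.beta ++ as.map Letter.alpha) *
              wordClass [Letter.alpha a, Letter.beta b] := by
          rw [wordClass_append, hcl, ← wordClass_append, ← wordClass_append]; simp
        rcases eq_or_ne a b with rfl | hab
        · refine ⟨bs, as, ?_, _, hvc, ?_⟩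
          · rw [hcl', wordClass_cancel, mul_one]
          · simp [hsum, sign]
        · refine absurd ?_ hw
          rw [hcl', wordClass_mismatch hab, wordClass_mul_dyckZero]

/-- Since no suffix of `u` has positive height, `u` reduces to letters `β` only; the inserted letter
meets no `α`, and the whole word has a normal form. -/
theorem insert_beta_mem_language {u v : List (Letter m)} (hu : u ∈ language m)
    (hv : v ∈ language m) (hs : ∀ u', u' <:+ u → (u'.map sign).sum ≤ 0) (b : Fin m) :
    u ++ (Letter.beta b :: v) ∈ language m := by
  obtain ⟨bs, as, hcl, u', hu', hsum⟩ := exists_normalForm hu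
  obtain ⟨bs', as', hcl', -⟩ := exists_normalForm hv
  have h0 : as = [] := by
    have := hs u' hu'
    rw [hsum] at this
    exact List.length_eq_zero_iff.1 (by omega)
  subst h0
  have h : wordClass (u ++ (Letter.beta b :: v)) =
      wordClass ((bs ++ b :: bs').map Letter.beta ++ as'.map Letter.alpha) := by
    rw [List.map_append, List.map_cons, List.append_assoc, List.cons_append,
      ← List.singleton_append, ← List.singleton_append (l := _ ++ _)]
    simp only [wordClass_append] at hcl hcl' ⊢
    rw [hcl, hcl', List.map_nil, wordClass_nil, mul_one]
  change wordClass _ ≠ _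
  rw [h]
  exact normalForm_mem_language _ _

end Monoid

/-! ### Blocks of a sequence and their heights. -/

section Blocks

variable {m : ℕ}

theorem block_of_lt (x : ℤ → Letter m) {r l : ℤ} (h : l < r) : block x r l = [] := by
  simp [block, Int.toNat_of_nonpos (by omega : l - r + 1 ≤ 0)]

theorem length_block (x : ℤ → Letter m) (r l : ℤ) : (block x r l).length = (l - r + 1).toNat := by
  simp [block]

theorem block_append (x : ℤ → Letter m) {r i l : ℤ} (h1 : r ≤ i) (h2 : i ≤ l + 1) :
    block x r l = block x r (i - 1) ++ block x i l := by
  have h : (l - r + 1).toNat = (i - 1 - r + 1).toNat + (l - i + 1).toNat := by omega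
  rw [block, h, List.range_add, List.map_append, List.map_map]
  refine congrArg₂ _ rfl (List.map_congr_left fun k _ => congrArg x ?_)
  simp only [Nat.cast_add]
  omega

theorem block_self (x : ℤ → Letter m) (i : ℤ) : block x i i = [x i] := by
  simp [block]

theorem block_congr {x y : ℤ → Letter m} {r l : ℤ} (h : ∀ k, r ≤ k → k ≤ l → x k = y k) :
    block x r l = block y r l := by
  refine List.map_congr_left fun k hk => h _ (by omega) ?_
  rw [List.mem_range] at hk
  omega

theorem nil_mem_language (hx : (shift m).Nonempty) : [] ∈ language m := by
  obtain ⟨x, hx⟩ := hx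
  exact (language_append (u := []) (hx 0 0 le_rfl)).1

theorem block_mem_language {x : ℤ → Letter m} (hx : x ∈ shift m) (r l : ℤ) :
    block x r l ∈ language m := by
  rcases lt_or_ge l r with h | h
  · rw [block_of_lt x h]; exact nil_mem_language ⟨x, hx⟩
  · exact hx r l h

theorem height_add_one (x : ℤ → Letter m) (i : ℤ) : height x (i + 1) = height x i + sign (x i) := by
  rcases lt_trichotomy i (-1) with h | rfl | h
  · have : Finset.Ico i 0 = insert i (Finset.Ico (i + 1) 0) := by ext; simp; omega
    rw [height, height, if_neg (by omega), if_neg (by omega), this, Finset.sum_insert (by simp)]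
    ring
  · have : Finset.Ico (-1 : ℤ) 0 = {-1} := by ext; simp; omega
    simp [height, this]
  · have : Finset.Ico 0 (i + 1) = insert i (Finset.Ico 0 i) := by ext; simp; omega
    rw [height, height, if_pos (by omega), if_pos (by omega), this, Finset.sum_insert (by simp)]
    ring

theorem height_sub_congr {x y : ℤ → Letter m} {a b : ℤ} (hab : a ≤ b)
    (h : ∀ i, a ≤ i → i < b → x i = y i) : height x b - height x a = height y b - height y a := by
  induction b, hab using Int.leInduction with
  | base => simp
  | succ b hab ih =>
    have := ih fun i h1 h2 => h i h1 (by omega)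
    rw [height_add_one, height_add_one, h b hab (by omega)]
    linarith

theorem sum_sign_block (x : ℤ → Letter m) {r i : ℤ} (h : r ≤ i) :
    ((block x r (i - 1)).map sign).sum = height x i - height x r := by
  induction i, h using Int.leInduction with
  | base => simp [block_of_lt x (by omega : r - 1 < r)]
  | succ i h ih =>
    rw [add_sub_cancel_right, block_append x h (by omega), List.map_append, List.sum_append, ih,
      block_self, height_add_one]
    simp
    ring

theorem exists_eq_block_of_suffix {x : ℤ → Letter m} {r i : ℤ} (h : r ≤ i) {v : List (Letter m)}
    (hv : v <:+ block x r (i - 1)) : ∃ j ≤ i, v = block x j (i - 1) := by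
  have hl := hv.length_le
  rw [length_block] at hl
  refine ⟨i - v.length, by omega, ?_⟩
  have h2 : block x (i - v.length) (i - 1) <:+ block x r (i - 1) :=
    ⟨_, (block_append x (by omega) (by omega)).symm⟩
  have hlen : v.length = (block x (i - v.length) (i - 1)).length := by
    rw [length_block]; omega
  exact (List.suffix_of_suffix_length_le hv h2 hlen.le).eq_of_length hlen

end Blocks

/-! ### Flipping one letter. -/

section Flip

variable {m : ℕ}

/-- The change of a letter `α_j` into `β_j` and conversely. -/
def Letter.swap : Letter m → Letter m
  | .alpha j => .beta j
  | .beta j => .alpha j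

theorem Letter.swap_swap (a : Letter m) : a.swap.swap = a := by cases a <;> rfl

/-- The change of the letter in position `k` of a sequence. -/
def flip (k : ℤ) (x : ℤ → Letter m) : ℤ → Letter m := Function.update x k (x k).swap

theorem flip_self (k : ℤ) (x : ℤ → Letter m) : flip k x k = (x k).swap := by simp [flip]

theorem flip_of_ne {k i : ℤ} (h : i ≠ k) (x : ℤ → Letter m) : flip k x i = x i := by
  simp [flip, h]

theorem flip_flip (k : ℤ) (x : ℤ → Letter m) : flip k (flip k x) = x := by
  simp [flip, Letter.swap_swap]

theorem flip_injective (k : ℤ) : Function.Injective (flip (m := m) k) :=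
  Function.LeftInverse.injective (flip_flip k)

theorem measurable_flip (k : ℤ) : Measurable (flip (m := m) k) := by
  refine measurable_pi_lambda _ fun i => ?_
  rcases eq_or_ne i k with rfl | h
  · simp only [flip_self]
    exact (measurable_of_finite Letter.swap).comp (measurable_pi_apply i)
  · simp only [flip_of_ne h]
    exact measurable_pi_apply i

theorem flip_mem_shift {x : ℤ → Letter m} (hx : x ∈ shift m) {k : ℤ} {a : Fin m}
    (ha : x k = Letter.alpha a) (hk : ∀ j ≤ k, height x k ≤ height x j) : flip k x ∈ shift m := by
  intro r l hrl
  by_cases hr : r ≤ k ∧ k ≤ l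
  · rw [block_append _ hr.1 (by omega), block_append _ (by omega : k ≤ k + 1) (by omega),
      add_sub_cancel_right, block_self, flip_self, ha,
      block_congr (y := x) (fun i _ _ => flip_of_ne (by omega) x),
      block_congr (r := k + 1) (y := x) (fun i _ _ => flip_of_ne (by omega) x)]
    refine insert_beta_mem_language (block_mem_language hx _ _) (block_mem_language hx _ _) ?_ a
    intro u hu
    obtain ⟨j, hj, rfl⟩ := exists_eq_block_of_suffix hr.1 hu
    rw [sum_sign_block x hj]
    linarith [hk j hj]
  · rw [block_congr (y := x) (fun i _ _ => flip_of_ne (by omega) x)]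
    exact hx r l hrl

/-- Heights are normalised at position 0, on either side of `k`, so only differences from the height
at `k` are compared. -/
theorem height_flip_of_le (x : ℤ → Letter m) {k j : ℤ} (h : j ≤ k) :
    height (flip k x) j - height (flip k x) k = height x j - height x k := by
  have := height_sub_congr (x := flip k x) (y := x) h fun i _ _ => flip_of_ne (by omega) x
  linarith

theorem height_flip_of_lt (x : ℤ → Letter m) {k j : ℤ} {a : Fin m} (ha : x k = Letter.alpha a)
    (h : k < j) : height (flip k x) j - height (flip k x) k = height x j - height x k - 2 := by
  have := height_sub_congr (x := flip k x) (y := x) (by omega : k + 1 ≤ j)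
    fun i _ _ => flip_of_ne (by omega) x
  rw [height_add_one, height_add_one, flip_self, ha] at this
  simp only [Letter.swap, sign] at this
  linarith

/-- The height has a global minimum in position `k`. -/
def IsMinAt (x : ℤ → Letter m) (k : ℤ) : Prop := ∀ j, height x k ≤ height x j

theorem IsMinAt.exists_alpha {x : ℤ → Letter m} {k : ℤ} (h : IsMinAt x k) :
    ∃ a, x k = Letter.alpha a := by
  have := h (k + 1)
  rw [height_add_one] at this
  cases hx : x k with
  | alpha a => exact ⟨a, rfl⟩
  | beta b => rw [hx] at this; simp [sign] at this

theorem measurable_height (k : ℤ) : Measurable fun x : shift m => height x.1 k := by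
  have h : ∀ j, Measurable fun x : shift m => sign (x.1 j) := fun j =>
    (measurable_of_finite sign).comp ((measurable_pi_apply j).comp measurable_subtype_coe)
  unfold height
  split_ifs
  · exact Finset.measurable_sum _ fun j _ => h j
  · exact Finset.measurable_sum _ fun j _ => (h j).neg

end Flip

/-! ### Positions of the minima and their change under a flip. -/

section Measure

variable {m : ℕ}

/-- The points whose height has a global minimum in position `k`. -/
def minSet (m : ℕ) (k : ℤ) : Set (shift m) := {x | IsMinAt x.1 k}

/-- The points whose height has its first global minimum in position `k`. -/
def firstMinSet (m : ℕ) (k : ℤ) : Set (shift m) :=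
  {x | IsMinAt x.1 k ∧ ∀ j < k, height x.1 k < height x.1 j}

/-- The points whose height has its last global minimum in position `k`. -/
def lastMinSet (m : ℕ) (k : ℤ) : Set (shift m) :=
  {x | IsMinAt x.1 k ∧ ∀ j > k, height x.1 k < height x.1 j}

/-- The points whose height has its global minimum in position `k` and in a later one. -/
def repeatedMinSet (m : ℕ) (k : ℤ) : Set (shift m) :=
  {x | IsMinAt x.1 k ∧ ∃ j > k, IsMinAt x.1 j}

/-- The points whose height is in position `k` for the first time one above its minimum. -/
def aboveMinSet (m : ℕ) (k : ℤ) : Set (shift m) :=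
  {x | (∀ j < k, height x.1 k < height x.1 j) ∧ ∃ j, IsMinAt x.1 j ∧ height x.1 k = height x.1 j + 1}

theorem measurableSet_minSet (k : ℤ) : MeasurableSet (minSet m k) := by
  simp only [minSet, IsMinAt, Set.ofPred_forall]
  exact MeasurableSet.iInter fun j => measurableSet_le (measurable_height k) (measurable_height j)

theorem measurableSet_firstMinSet (k : ℤ) : MeasurableSet (firstMinSet m k) := by
  refine (measurableSet_minSet k).inter (?_ : MeasurableSet {x : shift m | _})
  simp only [Set.ofPred_forall]
  exact MeasurableSet.iInter fun j => MeasurableSet.iInter fun _ =>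
    measurableSet_lt (measurable_height k) (measurable_height j)

theorem measurableSet_lastMinSet (k : ℤ) : MeasurableSet (lastMinSet m k) := by
  refine (measurableSet_minSet k).inter (?_ : MeasurableSet {x : shift m | _})
  simp only [Set.ofPred_forall]
  exact MeasurableSet.iInter fun j => MeasurableSet.iInter fun _ =>
    measurableSet_lt (measurable_height k) (measurable_height j)

theorem measurableSet_repeatedMinSet (k : ℤ) : MeasurableSet (repeatedMinSet m k) := by
  refine (measurableSet_minSet k).inter (?_ : MeasurableSet {x : shift m | ∃ j > k, IsMinAt x.1 j})
  simp only [Set.ofPred_exists, Set.ofPred_and]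
  exact MeasurableSet.iUnion fun j => (MeasurableSet.const _).inter (measurableSet_minSet j)

theorem measurableSet_aboveMinSet (k : ℤ) : MeasurableSet (aboveMinSet m k) := by
  refine MeasurableSet.inter (?_ : MeasurableSet {x : shift m | _})
    (?_ : MeasurableSet {x : shift m | _})
  · simp only [Set.ofPred_forall]
    exact MeasurableSet.iInter fun j => MeasurableSet.iInter fun _ =>
      measurableSet_lt (measurable_height k) (measurable_height j)
  · simp only [Set.ofPred_exists, Set.ofPred_and]
    exact MeasurableSet.iUnion fun j => (measurableSet_minSet j).inter
      (measurableSet_eq_fun (measurable_height k) ((measurable_height j).add_const 1))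

theorem flip_mem_of_isMinAt {x : shift m} {k : ℤ} (h : IsMinAt x.1 k) : flip k x.1 ∈ shift m := by
  obtain ⟨a, ha⟩ := h.exists_alpha
  exact flip_mem_shift x.2 ha fun j _ => h j

/-- Relative to position `k`, later heights were at least 1 and become at least -1, with -1 attained
at `k + 1`; earlier ones stay non-negative. -/
theorem flip_mem_firstMinSet {x : shift m} {k : ℤ} (h : x ∈ lastMinSet m k) :
    (⟨flip k x.1, flip_mem_of_isMinAt h.1⟩ : shift m) ∈ firstMinSet m (k + 1) := by
  obtain ⟨hmin, hlast⟩ := h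
  obtain ⟨a, ha⟩ := hmin.exists_alpha
  have h1 := height_flip_of_lt x.1 ha (lt_add_one k)
  have h1' : height x.1 (k + 1) = height x.1 k + 1 := by rw [height_add_one, ha]; rfl
  refine ⟨fun j => ?_, fun j hj => ?_⟩
  · rcases le_or_gt j k with hj | hj
    · have h2 := height_flip_of_le x.1 hj
      have h3 := hmin j
      simp only
      omega
    · have h2 := height_flip_of_lt x.1 ha hj
      have h3 := hlast j hj
      simp only
      omega
  · have h2 := height_flip_of_le x.1 (Int.lt_add_one_iff.1 hj)
    have h3 := hmin j
    simp only
    omega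

/-- Relative to position `k`, the later minimum drops to -2 and is the new minimum, while `k + 1` is
the first position at -1. -/
theorem flip_mem_aboveMinSet {x : shift m} {k : ℤ} (h : x ∈ repeatedMinSet m k) :
    (⟨flip k x.1, flip_mem_of_isMinAt h.1⟩ : shift m) ∈ aboveMinSet m (k + 1) := by
  obtain ⟨hmin, n, hkn, hn⟩ := h
  obtain ⟨a, ha⟩ := hmin.exists_alpha
  have h1 := height_flip_of_lt x.1 ha (lt_add_one k)
  have h1' : height x.1 (k + 1) = height x.1 k + 1 := by rw [height_add_one, ha]; rfl
  have hkn' := height_flip_of_lt x.1 ha hkn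
  have hkn_eq := le_antisymm (hmin n) (hn k)
  refine ⟨fun j hj => ?_, n, fun j => ?_, ?_⟩
  · have h2 := height_flip_of_le x.1 (Int.lt_add_one_iff.1 hj)
    have h3 := hmin j
    simp only
    omega
  · have h3 := hmin j
    rcases le_or_gt j k with hj | hj
    · have h2 := height_flip_of_le x.1 hj
      simp only
      omega
    · have h2 := height_flip_of_lt x.1 ha hj
      simp only
      omega
  · simp only
    omega

theorem disjoint_aboveMinSet {k l : ℤ} (h : k < l) :
    Disjoint (aboveMinSet m k) (aboveMinSet m l) := by
  rw [Set.disjoint_left]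
  rintro x ⟨-, i, hi, hki⟩ ⟨hl, j, hj, hlj⟩
  have := hl k h
  have := hi j
  have := hj i
  omega

theorem disjoint_firstMinSet {k l : ℤ} (h : k < l) :
    Disjoint (firstMinSet m k) (firstMinSet m l) := by
  rw [Set.disjoint_left]
  rintro x ⟨hk, -⟩ ⟨-, hl⟩
  exact absurd (hk l) (not_le.2 (hl k h))

theorem disjoint_lastMinSet {k l : ℤ} (h : k < l) :
    Disjoint (lastMinSet m k) (lastMinSet m l) := by
  rw [Set.disjoint_left]
  rintro x ⟨-, hk⟩ ⟨hl, -⟩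
  exact absurd (hl k) (not_le.2 (hk l h))

theorem pairwise_disjoint_nat {α : Type*} {f : ℤ → Set α}
    (h : ∀ {k l : ℤ}, k < l → Disjoint (f k) (f l)) (K : ℤ) :
    Pairwise (Function.onFun Disjoint fun n : ℕ => f (K + n)) := by
  intro a b hab
  rcases lt_or_gt_of_ne hab with h1 | h1
  · exact h (by omega)
  · exact (h (by omega)).symm

/-! ### Invariant measures and minima. -/

/-- An invariant measure does not decrease when a letter is changed in position `k`. -/
theorem measure_le_of_flip {μ : Measure (shift m)} (hμ : IsDoubleTailInvariant (shift m) μ)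
    {A C : Set (shift m)} (hA : MeasurableSet A) {k : ℤ} (hk : ∀ x ∈ A, IsMinAt x.1 k)
    (hC : ∀ x (hx : x ∈ A), (⟨flip k x.1, flip_mem_of_isMinAt (hk x hx)⟩ : shift m) ∈ C) :
    μ A ≤ μ C := by
  rw [hμ A (fun x => ⟨flip k x.1.1, flip_mem_of_isMinAt (hk x.1 x.2)⟩) ⟨hA, ?_, ?_, ?_⟩]
  · exact measure_mono (Set.range_subset_iff.2 fun x => hC x.1 x.2)
  · exact ((measurable_flip k).comp
      (measurable_subtype_coe.comp measurable_subtype_coe)).subtype_mk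
  · intro x y hxy
    exact Subtype.ext (Subtype.ext (flip_injective k (congrArg Subtype.val hxy)))
  · intro x
    refine ⟨k.natAbs, fun i hi => (flip_of_ne ?_ x.1.1).symm⟩
    rintro rfl
    simp at hi

theorem ae_eventually_notMem_repeatedMinSet {μ : Measure (shift m)} [IsProbabilityMeasure μ]
    (hμ : IsDoubleTailInvariant (shift m) μ) :
    ∀ᵐ x ∂μ, ∀ᶠ n : ℕ in atTop, x ∉ repeatedMinSet m (0 + n) := by
  refine ae_eventually_notMem (ne_top_of_le_ne_top (measure_ne_top μ Set.univ) ?_)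
  calc ∑' n : ℕ, μ (repeatedMinSet m (0 + n))
      ≤ ∑' n : ℕ, μ (aboveMinSet m (1 + n)) := ENNReal.tsum_le_tsum fun n => by
        have := measure_le_of_flip hμ (measurableSet_repeatedMinSet (0 + n)) (fun x hx => hx.1)
          (fun x hx => flip_mem_aboveMinSet hx)
        rwa [show (0 + n + 1 : ℤ) = 1 + n by ring] at this
    _ = μ (⋃ n : ℕ, aboveMinSet m (1 + n)) :=
        (measure_iUnion (pairwise_disjoint_nat disjoint_aboveMinSet 1)
          fun n => measurableSet_aboveMinSet _).symm
    _ ≤ μ Set.univ := measure_mono (Set.subset_univ _)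

/-- A minimum is followed by the last one, unless there are minima in arbitrarily late positions. -/
theorem exists_mem_lastMinSet {x : shift m}
    (hx : ∀ᶠ n : ℕ in atTop, x ∉ repeatedMinSet m (0 + n)) {k : ℤ} (hk : IsMinAt x.1 k) :
    ∃ n : ℕ, x ∈ lastMinSet m (k + n) := by
  by_contra! hno
  have step : ∀ l, k ≤ l → IsMinAt x.1 l → ∃ j > l, IsMinAt x.1 j := by
    intro l hkl hl
    by_contra! h
    refine hno (l - k).toNat ?_
    rw [show k + ((l - k).toNat : ℤ) = l by omega]
    refine ⟨hl, fun j hj => (hl j).lt_of_ne fun he => h j hj fun i => ?_⟩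
    rw [← he]
    exact hl i
  have far : ∀ n : ℕ, ∃ j, k + n ≤ j ∧ IsMinAt x.1 j := by
    intro n
    induction n with
    | zero => exact ⟨k, by simp, hk⟩
    | succ n ih =>
      obtain ⟨j, hj, hmin⟩ := ih
      obtain ⟨i, hi, hmin'⟩ := step j (by omega) hmin
      exact ⟨i, by push_cast; omega, hmin'⟩
  obtain ⟨N, hN⟩ := eventually_atTop.1 hx
  -- Adding `|k|` makes `j ≥ N` even when `k` is negative.
  obtain ⟨j, hj, hmin⟩ := far (N + k.natAbs)
  refine hN j.toNat (by omega) ?_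
  rw [show (0 + (j.toNat : ℤ)) = j by omega]
  exact ⟨hmin, step j (by omega) hmin⟩

theorem measure_lastMinSet_eq_zero {μ : Measure (shift m)} [IsProbabilityMeasure μ]
    (hμ : IsDoubleTailInvariant (shift m) μ) (K : ℤ) : μ (lastMinSet m K) = 0 := by
  have hsplit : ∑' n : ℕ, μ (lastMinSet m (K + n)) =
      μ (lastMinSet m K) + μ (⋃ n : ℕ, lastMinSet m (K + 1 + n)) := by
    rw [tsum_eq_zero_add' ENNReal.summable, measure_iUnion
      (pairwise_disjoint_nat disjoint_lastMinSet _) fun n => measurableSet_lastMinSet _]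
    simp only [Nat.cast_zero, add_zero, Nat.cast_add, Nat.cast_one]
    congr! 4
    ring_nf
  have hle : ∑' n : ℕ, μ (lastMinSet m (K + n)) ≤ μ (⋃ n : ℕ, lastMinSet m (K + 1 + n)) := by
    calc ∑' n : ℕ, μ (lastMinSet m (K + n))
        ≤ ∑' n : ℕ, μ (firstMinSet m (K + 1 + n)) := ENNReal.tsum_le_tsum fun n => by
          have := measure_le_of_flip hμ (measurableSet_lastMinSet (K + n)) (fun x hx => hx.1)
            (fun x hx => flip_mem_firstMinSet hx)
          rwa [show (K + n + 1 : ℤ) = K + 1 + n by ring] at this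
      _ = μ (⋃ n : ℕ, firstMinSet m (K + 1 + n)) :=
          (measure_iUnion (pairwise_disjoint_nat disjoint_firstMinSet _)
            fun n => measurableSet_firstMinSet _).symm
      _ ≤ μ (⋃ n : ℕ, lastMinSet m (K + 1 + n)) := by
          refine measure_mono_ae ?_
          -- Almost surely a first minimum is followed by a last one, at the same position or later.
          filter_upwards [ae_eventually_notMem_repeatedMinSet hμ] with x hx hxm
          obtain ⟨n, hn⟩ := Set.mem_iUnion.1 hxm
          obtain ⟨l, hl⟩ := exists_mem_lastMinSet hx hn.1
          refine Set.mem_iUnion.2 ⟨n + l, ?_⟩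
          rwa [Nat.cast_add, ← add_assoc]
  rw [hsplit] at hle
  -- The measure is finite, so the extra term `μ (lastMinSet m K)` must vanish.
  by_contra h
  exact absurd hle (not_le.2 (add_comm (μ (lastMinSet m K)) _ ▸
    ENNReal.lt_add_right (measure_ne_top μ _) h))

theorem ae_not_isMinAt {μ : Measure (shift m)} [IsProbabilityMeasure μ]
    (hμ : IsDoubleTailInvariant (shift m) μ) : ∀ᵐ x ∂μ, ∀ k, ¬ IsMinAt x.1 k := by
  have h0 : ∀ᵐ x ∂μ, ∀ k, x ∉ lastMinSet m k :=
    ae_all_iff.2 fun k => measure_eq_zero_iff_ae_notMem.1 (measure_lastMinSet_eq_zero hμ k)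
  filter_upwards [h0, ae_eventually_notMem_repeatedMinSet hμ] with x hx hx' k hk
  obtain ⟨n, hn⟩ := exists_mem_lastMinSet hx' hk
  exact hx _ hn

/-! ### Existence of a minimum. -/

theorem exists_int_eventually_le {f : ℤ → ℤ} {l : Filter ℤ}
    (h : liminf (fun i => ((f i : ℝ) : EReal)) l ≠ ⊥) : ∃ c : ℤ, ∀ᶠ i in l, c ≤ f i := by
  obtain ⟨c, -, hc⟩ := EReal.lt_iff_exists_real_btwn.1 (bot_lt_iff_ne_bot.2 h)
  refine ⟨⌊c⌋, (eventually_lt_of_lt_liminf hc).mono fun i hi => ?_⟩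
  have : c < f i := EReal.coe_lt_coe_iff.1 hi
  exact_mod_cast (Int.floor_le c).trans this.le

theorem exists_isMinAt {x : ℤ → Letter m}
    (h1 : liminf (fun i : ℤ => ((height x i : ℝ) : EReal)) atTop ≠ ⊥)
    (h2 : liminf (fun i : ℤ => ((height x i : ℝ) : EReal)) atBot ≠ ⊥) : ∃ k, IsMinAt x k := by
  obtain ⟨c, hc⟩ := exists_int_eventually_le h1
  obtain ⟨d, hd⟩ := exists_int_eventually_le h2
  obtain ⟨a, ha⟩ := eventually_atTop.1 hc
  obtain ⟨b, hb⟩ := eventually_atBot.1 hd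
  obtain ⟨e, he⟩ := ((Set.finite_Icc b a).image (height x)).bddBelow
  obtain ⟨v, ⟨k, rfl⟩, hv⟩ := Int.exists_least_of_bdd (P := fun v => ∃ k, height x k = v)
    ⟨min c (min d e), by
      rintro _ ⟨k, rfl⟩
      rcases le_total a k with h | h
      · exact (min_le_left _ _).trans (ha k h)
      rcases le_total k b with h' | h'
      · exact ((min_le_right _ _).trans (min_le_left _ _)).trans (hb k h')
      · exact ((min_le_right _ _).trans (min_le_right _ _)).trans (he ⟨k, ⟨h', h⟩, rfl⟩)⟩
    ⟨_, 0, rfl⟩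
  exact ⟨k, fun j => hv _ ⟨j, rfl⟩⟩

end Measure

end Dyck

theorem mainTheorem5 (m : ℕ) (hm : 1 < m) (s t : Set EReal)
    (hs : s = {⊤} ∨ s = Set.range ((↑) : ℝ → EReal))
    (ht : t = {⊤} ∨ t = Set.range ((↑) : ℝ → EReal)) :
    ¬ ∃ μ : MeasureTheory.Measure (Dyck.shift m), MeasureTheory.IsProbabilityMeasure μ ∧
      Dyck.IsDoubleTailInvariant (Dyck.shift m) μ ∧ μ (Dyck.B m s t) = 1 := by
  rintro ⟨μ, hprob, hμ, hB⟩
  have hbot : ∀ u : Set EReal, (u = {⊤} ∨ u = Set.range ((↑) : ℝ → EReal)) → ∀ z ∈ u, z ≠ ⊥ := by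
    rintro u (rfl | rfl) z hz
    · rw [Set.mem_singleton_iff.1 hz]; exact top_ne_bot
    · obtain ⟨r, rfl⟩ := hz; exact EReal.coe_ne_bot r
  refine one_ne_zero (hB.symm.trans (measure_eq_zero_iff_ae_notMem.2 ?_))
  filter_upwards [Dyck.ae_not_isMinAt hμ] with x hx hxB
  obtain ⟨k, hk⟩ := Dyck.exists_isMinAt (hbot s hs _ hxB.1) (hbot t ht _ hxB.2)
  exact hx k hk
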